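/- For integers $1\le k\le n$ let $R(n,k)$ be the set of $n\times n$ matrices with entries in $\{0,1\}$ all of whose rows have Euclidean norm $\sqrt{k}$ (equivalently, each row contains exactly $k$ ones), and let $M(n,k)=\max_{A\in R(n,k)}|\det A|$. For $k\ge 2$ put $$c_k=\sqrt{k-1}\,\exp\left(\frac{1}{2k}\sum_{j=1}^{k}\frac{1}{j}\ln\left(1+\frac{j}{k-1}\right)\right),$$ and put $c_1=1$. Then $M(n,k)\le c_k^{\,n}$ for all integers $1\le k\le n$. Moreover, as $k\to\infty$, $$c_k=\sqrt{k}-\frac{t_2}{2\sqrt{k}}+O\left(k^{-3/2}\right),\qquad t_2=1-\frac{\pi^2}{12},$$ and $|t_2-0.178|<0.0005$, that is, $t_2\approx 0.178$. -/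

import Mathlib

open Filter Asymptotics

namespace RowSumDet

/-- `R n k`: the `n × n` matrices with entries in `{0, 1}` all of whose rows have Euclidean
norm `√k`. -/
def R (n k : ℕ) : Set (Matrix (Fin n) (Fin n) ℝ) :=
  {A | (∀ i j, A i j = 0 ∨ A i j = 1) ∧ ∀ i, ‖WithLp.toLp 2 (A i)‖ = √(k : ℝ)}

/-- `M n k`: the maximum of `|det A|` over `A ∈ R n k`. For `k ≤ n` it is a genuine maximum,
see `isGreatest_M`. -/
noncomputable def M (n k : ℕ) : ℝ :=
  sSup ((fun A : Matrix (Fin n) (Fin n) ℝ => |A.det|) '' R n k)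

/-- `c k = √(k-1) · exp ((1/(2k)) ∑_{j=1}^k ln (1 + j/(k-1)) / j)` for `k ≥ 2`. The expression
is undefined at `k = 1`, where its limit (in real `k`, with `j = 1` as the only summand)
is `1`; this is taken as the value there. -/
noncomputable def c (k : ℕ) : ℝ :=
  if k = 1 then 1
  else √((k : ℝ) - 1) *
    Real.exp (1 / (2 * (k : ℝ)) *
      ∑ j ∈ Finset.Icc 1 k, Real.log (1 + (j : ℝ) / ((k : ℝ) - 1)) / (j : ℝ))

/-- `t₂ = 1 - π² / 12`. -/
noncomputable def t₂ : ℝ := 1 - Real.pi ^ 2 / 12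

theorem R_finite (n k : ℕ) : (R n k).Finite := by
  have h : (Set.pi Set.univ fun _ : Fin n =>
      Set.pi Set.univ fun _ : Fin n => ({0, 1} : Set ℝ)).Finite :=
    Set.Finite.pi fun _ => Set.Finite.pi fun _ => Set.toFinite _
  refine h.subset fun A hA => ?_
  intro i _ j _
  exact hA.1 i j

theorem R_nonempty {n k : ℕ} (hkn : k ≤ n) : (R n k).Nonempty := by
  refine ⟨fun _ j => if (j : ℕ) < k then 1 else 0, fun i j => ?_, fun i => ?_⟩
  · by_cases h : (j : ℕ) < k <;> simp [h]
  · rw [EuclideanSpace.norm_eq]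
    congr 1
    have : ∀ j : Fin n, ‖(if (j : ℕ) < k then (1 : ℝ) else 0)‖ ^ 2
        = if (j : ℕ) < k then (1 : ℝ) else 0 := by
      intro j
      by_cases h : (j : ℕ) < k <;> simp [h]
    simp only [this]
    rw [Fin.sum_univ_eq_sum_range (fun j => if j < k then (1 : ℝ) else 0) n, Finset.sum_ite]
    have hs : (Finset.range n).filter (fun j => j < k) = Finset.range k := by
      ext j
      simp only [Finset.mem_filter, Finset.mem_range]
      omega
    simp [hs]

theorem isGreatest_M {n k : ℕ} (hkn : k ≤ n) :
    IsGreatest ((fun A : Matrix (Fin n) (Fin n) ℝ => |A.det|) '' R n k) (M n k) :=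
  ⟨((R_nonempty hkn).image _).csSup_mem ((R_finite n k).image _),
    fun _ hx => le_csSup ((R_finite n k).image _).bddAbove hx⟩

end RowSumDet

/-!
# The determinant of 0-1 matrices with constant row sums

The bound on `M n k` for `k ≥ 2` is a Shearer-type covering argument for determinants of Gram
matrices. Let `A ∈ R n k`, let `P` be the lower triangular factor of the `LQ` decomposition of `A`
(Gram-Schmidt on the rows), so that `P Pᵀ = A Aᵀ` and `(det A)² = ∏ i, P i i ²`, and put `t = k - 1`.
For a column `c` let `S c` be the set of rows having a one in column `c`. The rows in `S c` have
squared norm `t + 1` and pairwise inner products at least `1`, which forces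
`∏ i ∈ S c, P i i ² ≤ t ^ d * (1 + d / t)` with `d = #(S c)` (`prod_diag_sq_le`). The right-hand side
is the determinant of `B = t I + J`, where `J` is the all-ones matrix: with `T` the block of `P` on
`S c × S c`, the matrix `Tᵀ B⁻¹ T` is positive semidefinite of trace at most `d`, so its determinant
is at most `1` by AM-GM (`det_sq_le_of_sum_le`).

Every row lies in exactly `k` of the sets `S c`. The product of these inequalities over all columns,
and AM-GM once more with `∑ c, #(S c) = n k`, therefore give
`(det A) ^ (2 k) ≤ (t ^ k * (1 + k / t)) ^ n` (`det_pow_le`). Since `log (1 + x) / x` is decreasing,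
`log (1 + k / t) ≤ ∑ j ≤ k, log (1 + j / t) / j` (`log_le_harmonicLogSum`), so the right-hand side is
at most `c k ^ (2 k n)`. For `k = 1` the bound is Hadamard's inequality.

For the asymptotics, `∑ j ≤ k - 1, log (1 + j / (k - 1)) / j` is the right Riemann sum with step
`1 / (k - 1)` of the decreasing function `log (1 + x) / x` on `[0, 1]`. Its antiderivative
`∑ (-1) ^ m x ^ (m + 1) / (m + 1) ^ 2` takes the value `π² / 12` at `1`, so the sum in `c k` differs
from `π² / 12` by at most `1 / (k - 1)` (`abs_harmonicLogSum_sub_le`). The expansion of `c k` follows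
from those of `√(1 - x)` and `exp` at `0`, with `x = 1 / k`.
-/

namespace RowSumDet
open Matrix

/-! ### AM-GM for positive semidefinite matrices -/

/-- AM-GM in normalized form. -/
theorem prod_le_one_of_sum_le_card {ι : Type*} [Fintype ι] {z : ι → ℝ} (hz : ∀ i, 0 ≤ z i)
    (h : ∑ i, z i ≤ Fintype.card ι) : ∏ i, z i ≤ 1 := by
  calc ∏ i, z i ≤ ∏ i, Real.exp (z i - 1) :=
        Finset.prod_le_prod (fun i _ => hz i) fun i _ => by
          linarith [Real.add_one_le_exp (z i - 1)]
    _ = Real.exp (∑ i, (z i - 1)) := (Real.exp_sum _ _).symm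
    _ ≤ 1 := by
        rw [Real.exp_le_one_iff, Finset.sum_sub_distrib]
        simpa using h

theorem det_le_one_of_trace_le_card {ι : Type*} [Fintype ι] [DecidableEq ι]
    {X : Matrix ι ι ℝ} (hX : X.PosSemidef) (h : X.trace ≤ Fintype.card ι) : X.det ≤ 1 := by
  rw [hX.isHermitian.det_eq_prod_eigenvalues]
  rw [hX.isHermitian.trace_eq_sum_eigenvalues] at h
  exact prod_le_one_of_sum_le_card hX.eigenvalues_nonneg h

/-- The matrix `I - J / (t + d)`, where `J` is the all-ones matrix and `d` the size of `ι`. For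
`t ≠ 0` and `t + d ≠ 0` it is `t (t I + J)⁻¹`. -/
noncomputable def deflation (ι : Type*) [Fintype ι] [DecidableEq ι] (t : ℝ) : Matrix ι ι ℝ :=
  1 - (t + Fintype.card ι)⁻¹ • Matrix.of fun _ _ => 1

section
variable {ι : Type*} [Fintype ι] [DecidableEq ι] {t : ℝ}

theorem dotProduct_deflation_mulVec (t : ℝ) (x : ι → ℝ) :
    x ⬝ᵥ (deflation ι t *ᵥ x) = ∑ i, x i ^ 2 - (∑ i, x i) ^ 2 / (t + Fintype.card ι) := by
  have h : deflation ι t *ᵥ x = fun i => x i - (t + Fintype.card ι)⁻¹ * ∑ j, x j := by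
    ext i
    rw [deflation, sub_mulVec, one_mulVec, smul_mulVec]
    simp [mulVec, dotProduct]
  rw [h]
  simp only [dotProduct, mul_sub, Finset.sum_sub_distrib, ← Finset.sum_mul]
  simp only [sq]
  ring

omit [DecidableEq ι] in
theorem dotProduct_deflation_mulVec_nonneg (ht : 0 < t) (x : ι → ℝ) :
    0 ≤ ∑ i, x i ^ 2 - (∑ i, x i) ^ 2 / (t + Fintype.card ι) := by
  have hd : (0 : ℝ) ≤ Fintype.card ι := Nat.cast_nonneg _
  have h := sq_sum_le_card_mul_sum_sq (s := (Finset.univ : Finset ι)) (f := x)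
  rw [Finset.card_univ] at h
  have hs : 0 ≤ ∑ i, x i ^ 2 := Finset.sum_nonneg fun i _ => sq_nonneg _
  rw [sub_nonneg, div_le_iff₀ (by linarith)]
  nlinarith

theorem posSemidef_deflation (ht : 0 < t) : (deflation ι t).PosSemidef := by
  refine PosSemidef.of_dotProduct_mulVec_nonneg ?_ fun x => ?_
  · ext i j
    simp [deflation, Matrix.one_apply, eq_comm]
  · rw [star_trivial, dotProduct_deflation_mulVec]
    exact dotProduct_deflation_mulVec_nonneg ht x

theorem det_deflation (ht : 0 < t) :
    (deflation ι t).det = t / (t + Fintype.card ι) := by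
  have hd : (0 : ℝ) ≤ Fintype.card ι := Nat.cast_nonneg _
  have h : deflation ι t = 1 + replicateCol Unit (fun _ : ι => -(t + Fintype.card ι : ℝ)⁻¹) *
      replicateRow Unit (fun _ : ι => (1 : ℝ)) := by
    ext i j
    simp [deflation, Matrix.mul_apply, sub_eq_add_neg]
  rw [h, det_one_add_replicateCol_mul_replicateRow]
  simp only [dotProduct, one_mul, Finset.sum_const, Finset.card_univ, nsmul_eq_mul]
  field_simp
  ring

/-- If `tr (Tᵀ (t I + J)⁻¹ T) ≤ d`, then `det T ^ 2 ≤ det (t I + J)`: AM-GM applied to the eigenvalues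
of `Tᵀ (t I + J)⁻¹ T`. The hypothesis spells out the trace, multiplied by `t`, column by column. -/
theorem det_sq_le_of_sum_le (ht : 0 < t) (T : Matrix ι ι ℝ)
    (h : ∑ l, (∑ i, T i l ^ 2 - (∑ i, T i l) ^ 2 / (t + Fintype.card ι)) ≤ t * Fintype.card ι) :
    T.det ^ 2 ≤ t ^ Fintype.card ι * (1 + Fintype.card ι / t) := by
  have hd : (0 : ℝ) ≤ Fintype.card ι := Nat.cast_nonneg _
  have hX : (t⁻¹ • (Tᵀ * deflation ι t * T)).PosSemidef :=
    ((posSemidef_deflation ht).conjTranspose_mul_mul_same T).smul (by positivity)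
  have htr : (Tᵀ * deflation ι t * T).trace
      = ∑ l, (∑ i, T i l ^ 2 - (∑ i, T i l) ^ 2 / (t + Fintype.card ι)) := by
    refine Finset.sum_congr rfl fun l _ => ?_
    rw [← dotProduct_deflation_mulVec t fun i => T i l, diag_apply, Matrix.mul_assoc]
    rfl
  have hdet := det_le_one_of_trace_le_card hX (by
    rw [trace_smul, htr, smul_eq_mul, inv_mul_le_iff₀ ht]
    exact h)
  rw [det_smul, det_mul, det_mul, det_transpose, det_deflation ht, inv_pow,
    inv_mul_le_iff₀ (by positivity), mul_one] at hdet
  have h2 : T.det * (t / (t + Fintype.card ι)) * T.det * (1 + Fintype.card ι / t)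
      = T.det ^ 2 := by
    field_simp
  rw [← h2]
  exact mul_le_mul_of_nonneg_right hdet (by positivity)
end

/-! ### Triangular factors of Gram matrices -/

/-- `P i l` is the coordinate of row `i` along the `l`-th vector of the orthonormal basis obtained
from the rows of `A` by Gram-Schmidt. -/
theorem exists_isLowerTriangular_mul_transpose_eq {n : ℕ} (A : Matrix (Fin n) (Fin n) ℝ) :
    ∃ P : Matrix (Fin n) (Fin n) ℝ, P.IsLowerTriangular ∧ P * Pᵀ = A * Aᵀ := by
  let v : Fin n → EuclideanSpace ℝ (Fin n) := fun i => WithLp.toLp 2 (A i)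
  let b := InnerProductSpace.gramSchmidtOrthonormalBasis (𝕜 := ℝ) (f := v)
    (by simp : Module.finrank ℝ (EuclideanSpace ℝ (Fin n)) = Fintype.card (Fin n))
  refine ⟨Matrix.of fun i l => inner ℝ (b l) (v i), ?_, ?_⟩
  · intro i j hij
    exact InnerProductSpace.gramSchmidtOrthonormalBasis_inv_triangular _ v hij
  · ext i j
    have h := b.sum_inner_mul_inner (v i) (v j)
    have h2 : inner ℝ (v i) (v j) = (A * Aᵀ) i j := by
      simp [v, PiLp.inner_apply, Matrix.mul_apply, mul_comm]
    rw [← h2, ← h, Matrix.mul_apply]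
    refine Finset.sum_congr rfl fun l _ => ?_
    simp [real_inner_comm]

theorem det_sq_eq_prod_diag_sq {n : ℕ} {A P : Matrix (Fin n) (Fin n) ℝ}
    (hP : P.IsLowerTriangular) (h : P * Pᵀ = A * Aᵀ) : A.det ^ 2 = ∏ i, P i i ^ 2 := by
  have := congrArg Matrix.det h
  rw [det_mul, det_mul, det_transpose, det_transpose, det_of_isLowerTriangular P hP] at this
  rw [Finset.prod_pow, sq, ← this, sq]

/-- The quadratic form of `deflation`, summed over all columns of `P` restricted to the rows in `S`,
depends only on the Gram matrix of these rows. -/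
theorem sum_sub_sq_sum_eq {n : ℕ} {A P : Matrix (Fin n) (Fin n) ℝ} (h : P * Pᵀ = A * Aᵀ)
    (S : Finset (Fin n)) (u : ℝ) :
    ∑ l, (∑ i : S, P i l ^ 2 - (∑ i : S, P i l) ^ 2 / u)
      = ∑ i : S, (A * Aᵀ) i i - (∑ i : S, ∑ j : S, (A * Aᵀ) i j) / u := by
  rw [Finset.sum_sub_distrib, ← Finset.sum_div, ← h]
  congr 1
  · rw [Finset.sum_comm]
    simp [Matrix.mul_apply, sq]
  · congr 1
    simp_rw [sq, Finset.sum_mul_sum, Matrix.mul_apply, transpose_apply]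
    rw [Finset.sum_comm]
    exact Finset.sum_congr rfl fun i _ => Finset.sum_comm

/-- The squared distances of the rows in `S` to the span of *all* preceding rows have product at most
`det (t I + J)`, when these rows have squared norm `t + 1` and pairwise inner products at least
`1`. -/
theorem prod_diag_sq_le {n : ℕ} {A P : Matrix (Fin n) (Fin n) ℝ}
    (hP : P.IsLowerTriangular) (h : P * Pᵀ = A * Aᵀ) {t : ℝ} (ht : 0 < t)
    (S : Finset (Fin n)) (hdiag : ∀ i ∈ S, (A * Aᵀ) i i = t + 1)
    (hoff : ∀ i ∈ S, ∀ j ∈ S, 1 ≤ (A * Aᵀ) i j) :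
    ∏ i ∈ S, P i i ^ 2 ≤ t ^ S.card * (1 + S.card / t) := by
  let T : Matrix S S ℝ := P.submatrix (↑) (↑)
  have hT : T.det = ∏ i : S, P i i := by
    rw [det_of_isLowerTriangular T fun i j hij => hP hij]
    rfl
  have hcard : Fintype.card S = S.card := Fintype.card_coe S
  have key : T.det ^ 2 ≤ t ^ Fintype.card S * (1 + Fintype.card S / t) := by
    refine det_sq_le_of_sum_le ht T ?_
    set u : ℝ := t + Fintype.card S with hu
    have hu0 : 0 < u := by positivity
    calc ∑ l : S, (∑ i, T i l ^ 2 - (∑ i, T i l) ^ 2 / u)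
        = ∑ l ∈ S, (∑ i : S, P i l ^ 2 - (∑ i : S, P i l) ^ 2 / u) :=
          Finset.sum_coe_sort S fun l => ∑ i : S, P i l ^ 2 - (∑ i : S, P i l) ^ 2 / u
      -- the columns outside `S` contribute nonnegatively, and make the Gram matrix appear
      _ ≤ ∑ l, (∑ i : S, P i l ^ 2 - (∑ i : S, P i l) ^ 2 / u) :=
          Finset.sum_le_sum_of_subset_of_nonneg (Finset.subset_univ S) fun l _ _ =>
            dotProduct_deflation_mulVec_nonneg ht fun i : S => P i l
      _ = ∑ i : S, (A * Aᵀ) i i - (∑ i : S, ∑ j : S, (A * Aᵀ) i j) / u :=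
          sum_sub_sq_sum_eq h S u
      _ ≤ (t + 1) * Fintype.card S - (Fintype.card S * u) / u := by
          have h1 : ∑ i : S, (A * Aᵀ) i i = (t + 1) * Fintype.card S := by
            rw [Finset.sum_congr rfl fun i _ => hdiag i.1 i.2]
            rw [Finset.sum_const, Finset.card_univ, nsmul_eq_mul, mul_comm]
          have h2 : Fintype.card S * u ≤ ∑ i : S, ∑ j : S, (A * Aᵀ) i j := by
            have : ∀ i : S, u ≤ ∑ j : S, (A * Aᵀ) i j := fun i => by
              calc u = ∑ j : S, (1 + if i = j then t else 0) := by
                    rw [Finset.sum_add_distrib, Finset.sum_ite_eq, hu]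
                    simp [add_comm]
                _ ≤ _ := Finset.sum_le_sum fun j _ => by
                    split_ifs with hij
                    · rw [← hij, hdiag i.1 i.2, add_comm]
                    · simpa using hoff i.1 i.2 j.1 j.2
            calc Fintype.card S * u = ∑ _i : S, u := by simp
              _ ≤ _ := Finset.sum_le_sum fun i _ => this i
          rw [h1]
          gcongr
      _ = t * Fintype.card S := by
          rw [mul_div_assoc, div_self hu0.ne']
          ring
  rwa [hT, hcard, ← Finset.prod_pow, Finset.prod_coe_sort S fun i => P i i ^ 2] at key

/-! ### The determinant bound -/

theorem mem_R_iff {n k : ℕ} {A : Matrix (Fin n) (Fin n) ℝ} :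
    A ∈ R n k ↔ (∀ i j, A i j = 0 ∨ A i j = 1) ∧ ∀ i, (A * Aᵀ) i i = k := by
  refine and_congr_right fun _ => forall_congr' fun i => ?_
  rw [EuclideanSpace.norm_eq, Real.sqrt_inj (by positivity) (by positivity)]
  simp [Matrix.mul_apply, sq]

theorem sum_row_eq {n k : ℕ} {A : Matrix (Fin n) (Fin n) ℝ} (hA : A ∈ R n k) (i : Fin n) :
    ∑ j, A i j = k := by
  obtain ⟨h01, hd⟩ := mem_R_iff.1 hA
  rw [← hd i, Matrix.mul_apply]
  refine Finset.sum_congr rfl fun j _ => ?_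
  rcases h01 i j with h | h <;> simp [h]

theorem abs_det_le_one_of_mem_R_one {n : ℕ} {A : Matrix (Fin n) (Fin n) ℝ} (hA : A ∈ R n 1) :
    |A.det| ≤ 1 := by
  obtain ⟨P, hP, h⟩ := exists_isLowerTriangular_mul_transpose_eq A
  rw [← sq_le_one_iff_abs_le_one, det_sq_eq_prod_diag_sq hP h]
  refine Finset.prod_le_one (fun i _ => sq_nonneg _) fun i _ => ?_
  have hi := (mem_R_iff.1 hA).2 i
  rw [← h, Matrix.mul_apply, Nat.cast_one] at hi
  rw [← hi, sq]
  exact Finset.single_le_sum (f := fun j => P i j * Pᵀ j i)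
    (fun j _ => mul_self_nonneg _) (Finset.mem_univ i)

/-- Multiplying `prod_diag_sq_le` over all columns covers every row exactly `k` times. -/
theorem det_pow_le {n k : ℕ} (hk : 2 ≤ k) {A : Matrix (Fin n) (Fin n) ℝ} (hA : A ∈ R n k) :
    (A.det ^ 2) ^ k ≤ (((k : ℝ) - 1) ^ k * (1 + k / ((k : ℝ) - 1))) ^ n := by
  obtain ⟨h01, hdiag⟩ := mem_R_iff.1 hA
  obtain ⟨P, hP, h⟩ := exists_isLowerTriangular_mul_transpose_eq A
  have hk' : (2 : ℝ) ≤ k := by exact_mod_cast hk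
  set t : ℝ := (k : ℝ) - 1 with ht_def
  have ht : 0 < t := by linarith
  let S : Fin n → Finset (Fin n) := fun c => Finset.univ.filter fun i => A i c = 1
  have hentry : ∀ i c, A i c = if A i c = 1 then 1 else 0 := fun i c => by
    rcases h01 i c with h | h <;> simp [h]
  have hrow : ∀ i, (Finset.univ.filter fun c => A i c = 1).card = k := fun i => by
    have := sum_row_eq hA i
    rw [Finset.sum_congr rfl fun c _ => hentry i c, Finset.sum_boole] at this
    exact_mod_cast this
  have hsum : ∑ c, (S c).card = n * k := by
    calc ∑ c, (S c).card = ∑ c, ∑ i, if A i c = 1 then 1 else 0 := by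
          simp only [S, Finset.card_filter]
      _ = ∑ i, ∑ c, if A i c = 1 then 1 else 0 := Finset.sum_comm
      _ = ∑ _i : Fin n, k := Finset.sum_congr rfl fun i _ => by
          rw [← Finset.card_filter, hrow]
      _ = n * k := by simp
  have hprod : (A.det ^ 2) ^ k = ∏ c, ∏ i ∈ S c, P i i ^ 2 := by
    rw [det_sq_eq_prod_diag_sq hP h, ← Finset.prod_pow]
    simp only [S, Finset.prod_filter]
    rw [Finset.prod_comm]
    refine Finset.prod_congr rfl fun i _ => ?_
    rw [← Finset.prod_filter, Finset.prod_const, hrow]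
  have hcol : ∀ c, ∏ i ∈ S c, P i i ^ 2 ≤ t ^ (S c).card * (1 + (S c).card / t) := fun c => by
    refine prod_diag_sq_le hP h ht (S c) (fun i _ => ?_) fun i hi j hj => ?_
    · rw [hdiag i, ht_def]
      ring
    · have hi' : A i c = 1 := (Finset.mem_filter.1 hi).2
      have hj' : A j c = 1 := (Finset.mem_filter.1 hj).2
      have h0 : ∀ i l, 0 ≤ A i l := fun i l => by rcases h01 i l with h | h <;> norm_num [h]
      have := Finset.single_le_sum (f := fun l => A i l * Aᵀ l j)
        (fun l _ => mul_nonneg (h0 i l) (h0 j l)) (Finset.mem_univ c)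
      rw [Matrix.mul_apply]
      simpa [hi', hj'] using this
  have hB : 0 < 1 + k / t := by positivity
  have hamgm : ∏ c, (1 + (S c).card / t) ≤ (1 + k / t) ^ n := by
    have h1 : ∏ c, ((1 + (S c).card / t) / (1 + k / t)) ≤ 1 := by
      refine prod_le_one_of_sum_le_card (fun c => div_nonneg (add_nonneg zero_le_one
        (div_nonneg (Nat.cast_nonneg _) ht.le)) hB.le) ?_
      rw [← Finset.sum_div, Finset.sum_add_distrib, ← Finset.sum_div, ← Nat.cast_sum, hsum,
        div_le_iff₀ hB]
      simp
      apply le_of_eq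
      ring
    rw [Finset.prod_div_distrib, div_le_iff₀ (by positivity)] at h1
    simpa using h1
  calc (A.det ^ 2) ^ k = ∏ c, ∏ i ∈ S c, P i i ^ 2 := hprod
    _ ≤ ∏ c, (t ^ (S c).card * (1 + (S c).card / t)) :=
        Finset.prod_le_prod (fun c _ => Finset.prod_nonneg fun i _ => sq_nonneg _)
          fun c _ => hcol c
    _ = t ^ (n * k) * ∏ c, (1 + (S c).card / t) := by
        rw [Finset.prod_mul_distrib, Finset.prod_pow_eq_pow_sum, hsum]
    _ ≤ t ^ (n * k) * (1 + k / t) ^ n := by gcongr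
    _ = (t ^ k * (1 + k / t)) ^ n := by rw [mul_pow, ← pow_mul, mul_comm k n]

/-- `log (1 + x) / x` is decreasing on the positive reals; this is Bernoulli's inequality
`(1 + y) ^ (x / y) ≤ 1 + x`. -/
theorem log_one_add_div_le {x y : ℝ} (hx : 0 < x) (hxy : x ≤ y) :
    Real.log (1 + y) / y ≤ Real.log (1 + x) / x := by
  have hy : 0 < y := hx.trans_le hxy
  have h := rpow_one_add_le_one_add_mul_self (s := y) (p := x / y) (by linarith)
    (by positivity) ((div_le_one hy).2 hxy)
  have hlog := Real.log_le_log (by positivity) h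
  rw [Real.log_rpow (by positivity), div_mul_cancel₀ _ hy.ne'] at hlog
  rw [le_div_iff₀ hx]
  calc _ = x / y * Real.log (1 + y) := by ring
    _ ≤ _ := hlog

/-- The sum in the exponent of `c k`. -/
noncomputable def harmonicLogSum (k : ℕ) : ℝ :=
  ∑ j ∈ Finset.Icc 1 k, Real.log (1 + (j : ℝ) / ((k : ℝ) - 1)) / (j : ℝ)

/-- By `log_one_add_div_le`, each of the `k` summands is at least the last one,
`log (1 + k / (k - 1)) / k`. -/
theorem log_le_harmonicLogSum {k : ℕ} (hk : 2 ≤ k) :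
    Real.log (1 + k / ((k : ℝ) - 1)) ≤ harmonicLogSum k := by
  have hk' : (2 : ℝ) ≤ k := by exact_mod_cast hk
  have ht : 0 < (k : ℝ) - 1 := by linarith
  set t : ℝ := (k : ℝ) - 1
  have hk0 : (0 : ℝ) < k := by linarith
  calc Real.log (1 + k / t)
      = ∑ j ∈ Finset.Icc 1 k, Real.log (1 + k / t) / k := by
        rw [Finset.sum_const, Nat.card_Icc, Nat.add_sub_cancel, nsmul_eq_mul,
          mul_div_cancel₀ _ hk0.ne']
    _ ≤ _ := Finset.sum_le_sum fun j hj => by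
        obtain ⟨hj1, hjk⟩ := Finset.mem_Icc.1 hj
        have hj0 : (0 : ℝ) < j := by exact_mod_cast hj1
        have hjk' : (j : ℝ) / t ≤ k / t := by gcongr
        have h := log_one_add_div_le (div_pos hj0 ht) hjk'
        rwa [div_div_eq_mul_div, div_div_eq_mul_div, mul_div_right_comm, mul_div_right_comm,
          mul_le_mul_iff_left₀ ht] at h

theorem c_eq {k : ℕ} (hk : 2 ≤ k) :
    c k = √((k : ℝ) - 1) * Real.exp (harmonicLogSum k / (2 * k)) := by
  rw [c, if_neg (by omega), harmonicLogSum]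
  congr 2
  ring

theorem le_c_sq_pow {k : ℕ} (hk : 2 ≤ k) :
    ((k : ℝ) - 1) ^ k * (1 + k / ((k : ℝ) - 1)) ≤ (c k ^ 2) ^ k := by
  have hk' : (2 : ℝ) ≤ k := by exact_mod_cast hk
  have ht : 0 < (k : ℝ) - 1 := by linarith
  have hk0 : (k : ℝ) ≠ 0 := by positivity
  rw [c_eq hk, mul_pow, Real.sq_sqrt ht.le, mul_pow]
  gcongr
  rw [← Real.exp_nat_mul, ← Real.exp_nat_mul, ← Real.log_le_iff_le_exp (by positivity)]
  convert log_le_harmonicLogSum hk using 1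
  push_cast
  field_simp

theorem c_nonneg (k : ℕ) : 0 ≤ c k := by
  unfold c
  split_ifs <;> positivity

theorem M_le_c_pow {n k : ℕ} (hk : 1 ≤ k) (hkn : k ≤ n) : M n k ≤ c k ^ n := by
  obtain ⟨A, hA, hdet⟩ := (isGreatest_M hkn).1
  rw [← hdet]
  change |A.det| ≤ _
  rcases hk.eq_or_lt with rfl | hk2
  · simpa [c] using abs_det_le_one_of_mem_R_one hA
  · refine le_of_pow_le_pow_left₀ (n := 2 * k) (by omega) (pow_nonneg (c_nonneg k) n) ?_
    calc |A.det| ^ (2 * k) = (A.det ^ 2) ^ k := by rw [pow_mul, sq_abs]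
      _ ≤ (((k : ℝ) - 1) ^ k * (1 + k / ((k : ℝ) - 1))) ^ n := det_pow_le hk2 hA
      _ ≤ ((c k ^ 2) ^ k) ^ n := by
          have hk' : (1 : ℝ) ≤ k := by exact_mod_cast hk
          have := sub_nonneg.2 hk'
          exact pow_le_pow_left₀ (by positivity) (le_c_sq_pow hk2) n
      _ = (c k ^ n) ^ (2 * k) := by rw [← pow_mul, ← pow_mul, ← pow_mul]; congr 1; ring

/-! ### The antiderivative of `log (1 + x) / x` -/

/-- The power series `-Li₂(-x)`, the antiderivative of `log (1 + x) / x` that vanishes at `0`. It is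
used on `[0, 1]`, where the series converges. -/
noncomputable def negDilogNeg (x : ℝ) : ℝ := ∑' m : ℕ, (-1) ^ m * x ^ (m + 1) / ((m : ℝ) + 1) ^ 2

theorem summable_one_div_succ_sq : Summable fun m : ℕ => 1 / ((m : ℝ) + 1) ^ 2 := by
  simpa using (summable_nat_add_iff 1).2 hasSum_zeta_two.summable

theorem norm_negDilogNeg_term_le {x : ℝ} (hx : |x| ≤ 1) (m : ℕ) :
    ‖(-1) ^ m * x ^ (m + 1) / ((m : ℝ) + 1) ^ 2‖ ≤ 1 / ((m : ℝ) + 1) ^ 2 := by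
  rw [norm_div, norm_mul, norm_pow, norm_neg, norm_one, one_pow, one_mul, norm_pow,
    Real.norm_eq_abs, Real.norm_of_nonneg (by positivity)]
  gcongr
  exact pow_le_one₀ (abs_nonneg x) hx

theorem continuousOn_negDilogNeg : ContinuousOn negDilogNeg (Set.Icc 0 1) := by
  refine continuousOn_tsum (fun m => by fun_prop) summable_one_div_succ_sq fun m x hx => ?_
  exact norm_negDilogNeg_term_le (abs_le.2 ⟨by linarith [hx.1], hx.2⟩) m

theorem negDilogNeg_zero : negDilogNeg 0 = 0 := by simp [negDilogNeg]

/-- The alternating sum is `ζ(2)` minus twice its even part, and the even part is `ζ(2) / 4`. -/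
theorem negDilogNeg_one : negDilogNeg 1 = Real.pi ^ 2 / 12 := by
  have hinj : Function.Injective fun m : ℕ => 2 * m := fun a b h => by simpa using h
  have heven : HasSum (fun n : ℕ => if Even n then (1 : ℝ) / (n : ℝ) ^ 2 else 0)
      (Real.pi ^ 2 / 24) := by
    rw [← hinj.hasSum_iff fun n hn => if_neg fun he => hn ?_]
    · have h := hasSum_zeta_two.mul_left (1 / 4)
      rw [show 1 / 4 * (Real.pi ^ 2 / 6) = Real.pi ^ 2 / 24 by ring] at h
      have hcomp : (fun n : ℕ => if Even n then (1 : ℝ) / (n : ℝ) ^ 2 else 0) ∘ (fun m => 2 * m)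
          = fun m : ℕ => 1 / 4 * (1 / (m : ℝ) ^ 2) := funext fun m => by
        rw [Function.comp_apply, if_pos (even_two_mul m)]
        push_cast
        ring
      rwa [hcomp]
    · obtain ⟨m, hm⟩ := he
      exact ⟨m, by simp only; omega⟩
  have h := hasSum_zeta_two.sub (heven.mul_left 2)
  rw [← hasSum_nat_add_iff' 1, Finset.sum_range_one,
    show Real.pi ^ 2 / 6 - 2 * (Real.pi ^ 2 / 24) - (1 / ((0 : ℕ) : ℝ) ^ 2 -
      2 * if Even 0 then 1 / ((0 : ℕ) : ℝ) ^ 2 else 0) = Real.pi ^ 2 / 12 by simp; ring] at h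
  rw [negDilogNeg, ← h.tsum_eq]
  refine tsum_congr fun m => ?_
  rcases Nat.even_or_odd m with hm | hm
  · have : ¬ Even (m + 1) := by simpa [Nat.even_add_one] using hm
    rw [if_neg this, hm.neg_one_pow]
    simp
  · rw [if_pos hm.add_one, hm.neg_one_pow]
    simp
    ring

theorem hasDerivAt_negDilogNeg {x : ℝ} (hx0 : 0 < x) (hx1 : x < 1) :
    HasDerivAt negDilogNeg (Real.log (1 + x) / x) x := by
  obtain ⟨r, hxr, hr1⟩ := exists_between hx1
  have hr0 : 0 < r := hx0.trans hxr
  have h := hasDerivAt_tsum_of_isPreconnected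
    (g := fun (m : ℕ) (x : ℝ) => (-1) ^ m * x ^ (m + 1) / ((m : ℝ) + 1) ^ 2)
    (g' := fun (m : ℕ) (x : ℝ) => (-1) ^ m * x ^ m / ((m : ℝ) + 1))
    (u := fun m => r ^ m) (t := Set.Ioo (-r) r) (y₀ := x) (y := x)
    (summable_geometric_of_lt_one hr0.le hr1) isOpen_Ioo isPreconnected_Ioo
    (fun m y _ => ?_) (fun m y hy => ?_) ⟨by linarith, hxr⟩ ?_ ⟨by linarith, hxr⟩
  · refine h.congr_deriv ?_
    have hlog := Real.hasSum_pow_div_log_of_abs_lt_one (x := -x)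
      (by rwa [abs_neg, abs_of_pos hx0])
    have := hlog.mul_left (-x⁻¹)
    rw [sub_neg_eq_add] at this
    rw [show Real.log (1 + x) / x = -x⁻¹ * -Real.log (1 + x) by ring, ← this.tsum_eq]
    refine tsum_congr fun m => ?_
    rw [neg_pow x (m + 1), pow_succ, pow_succ]
    field_simp
  · have := (((hasDerivAt_pow (m + 1) y).const_mul ((-1 : ℝ) ^ m)).div_const (((m : ℝ) + 1) ^ 2))
    refine this.congr_deriv ?_
    push_cast
    field_simp
  · rw [norm_div, norm_mul, norm_pow, norm_neg, norm_one, one_pow, one_mul, norm_pow,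
      Real.norm_eq_abs, Real.norm_of_nonneg (by positivity)]
    calc |y| ^ m / ((m : ℝ) + 1) ≤ |y| ^ m :=
          div_le_self (by positivity) (by linarith [(Nat.cast_nonneg m : (0 : ℝ) ≤ m)])
      _ ≤ r ^ m := by
          gcongr
          exact (abs_lt.2 hy).le
  · exact .of_norm_bounded summable_one_div_succ_sq
      (norm_negDilogNeg_term_le (by rw [abs_of_pos hx0]; exact hx1.le))

theorem exists_negDilogNeg_sub_eq {a b : ℝ} (ha : 0 ≤ a) (hab : a < b) (hb : b ≤ 1) :
    ∃ ξ ∈ Set.Ioo a b, negDilogNeg b - negDilogNeg a = (b - a) * (Real.log (1 + ξ) / ξ) := by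
  obtain ⟨ξ, hξ, h⟩ := exists_hasDerivAt_eq_slope negDilogNeg (fun x => Real.log (1 + x) / x) hab
    (continuousOn_negDilogNeg.mono (Set.Icc_subset_Icc ha hb))
    fun x hx => hasDerivAt_negDilogNeg (ha.trans_lt hx.1) (hx.2.trans_le hb)
  refine ⟨ξ, hξ, ?_⟩
  have h' : Real.log (1 + ξ) / ξ = (negDilogNeg b - negDilogNeg a) / (b - a) := h
  rw [h', mul_div_cancel₀ _ (sub_pos.2 hab).ne']

/-! ### Riemann sums of `log (1 + x) / x` -/

theorem log_one_add_div_le_one {x : ℝ} (hx : 0 < x) : Real.log (1 + x) / x ≤ 1 := by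
  rw [div_le_one hx]
  linarith [Real.log_le_sub_one_of_pos (by linarith : 0 < 1 + x)]

/-- The summand as step length `1 / N` times the value of `log (1 + x) / x` at `x = j / N`. -/
theorem log_term_eq (N j : ℕ) (hN : 0 < N) : Real.log (1 + (j : ℝ) / N) / j
    = (N : ℝ)⁻¹ * (Real.log (1 + (j : ℝ) / N) / (j / N)) := by
  have : (N : ℝ) ≠ 0 := by positivity
  field_simp

theorem sum_log_div_le {N : ℕ} (hN : 0 < N) :
    ∑ j ∈ Finset.range N, Real.log (1 + ((j + 1 : ℕ) : ℝ) / N) / (j + 1 : ℕ)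
      ≤ Real.pi ^ 2 / 12 := by
  have hN' : (0 : ℝ) < N := by exact_mod_cast hN
  calc _ ≤ ∑ j ∈ Finset.range N, (negDilogNeg ((j + 1 : ℕ) / N) - negDilogNeg ((j : ℕ) / N)) :=
        Finset.sum_le_sum fun j hj => by
          have hjN : ((j + 1 : ℕ) : ℝ) ≤ N := by exact_mod_cast Finset.mem_range.1 hj
          obtain ⟨ξ, hξ, h⟩ := exists_negDilogNeg_sub_eq (a := j / N) (b := (j + 1 : ℕ) / N)
            (by positivity) (by gcongr; simp) ((div_le_one hN').2 hjN)
          rw [h, log_term_eq N _ hN,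
            show ((j + 1 : ℕ) : ℝ) / N - j / N = (N : ℝ)⁻¹ by push_cast; ring]
          refine mul_le_mul_of_nonneg_left ?_ (by positivity)
          exact log_one_add_div_le (lt_of_le_of_lt (by positivity) hξ.1) hξ.2.le
    _ = Real.pi ^ 2 / 12 := by
        rw [Finset.sum_range_sub fun j : ℕ => negDilogNeg ((j : ℝ) / N), div_self hN'.ne']
        simp [negDilogNeg_zero, negDilogNeg_one]

theorem le_sum_log_div {N : ℕ} (hN : 0 < N) :
    Real.pi ^ 2 / 12 ≤ (N : ℝ)⁻¹ +
      ∑ j ∈ Finset.range N, Real.log (1 + ((j + 1 : ℕ) : ℝ) / N) / (j + 1 : ℕ) := by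
  have hN' : (0 : ℝ) < N := by exact_mod_cast hN
  -- `g j` is the `j`-th term of the left Riemann sum, the integrand being `1` at `0` by continuity
  let g : ℕ → ℝ := fun j => if j = 0 then (N : ℝ)⁻¹ else Real.log (1 + (j : ℝ) / N) / j
  have hg : ∀ j ∈ Finset.range N,
      negDilogNeg ((j + 1 : ℕ) / N) - negDilogNeg ((j : ℕ) / N) ≤ g j := fun j hj => by
    have hjN : ((j + 1 : ℕ) : ℝ) ≤ N := by exact_mod_cast Finset.mem_range.1 hj
    obtain ⟨ξ, hξ, h⟩ := exists_negDilogNeg_sub_eq (a := j / N) (b := (j + 1 : ℕ) / N)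
      (by positivity) (by gcongr; simp) ((div_le_one hN').2 hjN)
    have hξ0 : 0 < ξ := lt_of_le_of_lt (by positivity) hξ.1
    rw [h, show ((j + 1 : ℕ) : ℝ) / N - j / N = (N : ℝ)⁻¹ by push_cast; ring]
    rcases Nat.eq_zero_or_pos j with rfl | hj0
    · simpa [g] using mul_le_mul_of_nonneg_left (log_one_add_div_le_one hξ0)
        (inv_nonneg.2 hN'.le)
    · simp only [g, if_neg hj0.ne']
      rw [log_term_eq N _ hN]
      have : (0 : ℝ) < j := by exact_mod_cast hj0
      refine mul_le_mul_of_nonneg_left ?_ (by positivity)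
      exact log_one_add_div_le (by positivity) hξ.1.le
  calc Real.pi ^ 2 / 12
      = ∑ j ∈ Finset.range N, (negDilogNeg ((j + 1 : ℕ) / N) - negDilogNeg ((j : ℕ) / N)) := by
        rw [Finset.sum_range_sub fun j : ℕ => negDilogNeg ((j : ℝ) / N), div_self hN'.ne']
        simp [negDilogNeg_zero, negDilogNeg_one]
    _ ≤ ∑ j ∈ Finset.range N, g j := Finset.sum_le_sum hg
    _ ≤ ∑ j ∈ Finset.range (N + 1), g j := by
        rw [Finset.sum_range_succ]
        refine le_add_of_nonneg_right ?_
        simp only [g, if_neg hN.ne']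
        exact div_nonneg (Real.log_nonneg (by rw [div_self hN'.ne']; norm_num)) hN'.le
    _ = _ := by
        rw [Finset.sum_range_succ', add_comm]
        simp [g]

theorem abs_harmonicLogSum_sub_le {k : ℕ} (hk : 2 ≤ k) :
    |harmonicLogSum k - Real.pi ^ 2 / 12| ≤ 1 / ((k : ℝ) - 1) := by
  obtain ⟨N, rfl⟩ : ∃ N, k = N + 1 := ⟨k - 1, by omega⟩
  have hN : 0 < N := by omega
  have hN' : (0 : ℝ) < N := by exact_mod_cast hN
  have h : harmonicLogSum (N + 1)
      = ∑ j ∈ Finset.range N, Real.log (1 + ((j + 1 : ℕ) : ℝ) / N) / (j + 1 : ℕ)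
        + Real.log (1 + ((N + 1 : ℕ) : ℝ) / N) / (N + 1 : ℕ) := by
    rw [harmonicLogSum, Finset.sum_Icc_succ_top (by omega), Finset.range_eq_Ico,
      Finset.sum_Ico_add' (fun j : ℕ => Real.log (1 + (j : ℝ) / N) / j) 0 N 1]
    simp only [Nat.cast_add, Nat.cast_one, add_sub_cancel_right, zero_add]
    rfl
  have hlast0 : 0 ≤ Real.log (1 + ((N + 1 : ℕ) : ℝ) / N) / (N + 1 : ℕ) :=
    div_nonneg (Real.log_nonneg (le_add_of_nonneg_right (by positivity))) (by positivity)
  have hlast1 : Real.log (1 + ((N + 1 : ℕ) : ℝ) / N) / (N + 1 : ℕ) ≤ (N : ℝ)⁻¹ := by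
    rw [log_term_eq N _ hN]
    exact mul_le_of_le_one_right (by positivity) (log_one_add_div_le_one (by positivity))
  have h1 := sum_log_div_le hN
  have h2 := le_sum_log_div hN
  rw [show ((N + 1 : ℕ) : ℝ) - 1 = N by push_cast; ring, one_div, h, abs_le]
  constructor <;> linarith

/-! ### Asymptotics of `c k` -/

theorem abs_sqrt_one_sub_sub_le {x : ℝ} (hx0 : 0 ≤ x) (hx : x ≤ 1 / 2) :
    |√(1 - x) - (1 - x / 2)| ≤ x ^ 2 := by
  rw [abs_le]
  constructor
  · have : 1 - x / 2 - x ^ 2 ≤ √(1 - x) := Real.le_sqrt_of_sq_le (by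
      have : 0 ≤ 7 / 4 - x - x ^ 2 := by nlinarith
      nlinarith [mul_nonneg (sq_nonneg x) this])
    linarith
  · have : √(1 - x) ≤ 1 - x / 2 := Real.sqrt_le_iff.2 ⟨by linarith, by nlinarith⟩
    nlinarith

/-- With `x = 1 / k` and `S = harmonicLogSum k`, the product on the left is `c k / √k`. -/
theorem abs_sqrt_mul_exp_sub_le {x L S : ℝ} (hx0 : 0 ≤ x) (hx : x ≤ 1 / 2) (hL0 : 0 ≤ L)
    (hL1 : L ≤ 1) (hS : |S - L| ≤ 2 * x) :
    |√(1 - x) * Real.exp (x * S / 2) - (1 - x / 2 + x * L / 2)| ≤ 4 * x ^ 2 := by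
  have hSL := abs_le.1 hS
  have hy : |x * S / 2| ≤ x := by
    rw [abs_le]
    constructor <;> nlinarith
  have hexp := abs_le.1 ((Real.abs_exp_sub_one_sub_id_le (hy.trans (by linarith))).trans
    (sq_le_sq' (abs_le.1 hy).1 (abs_le.1 hy).2))
  have hsqrt := abs_sqrt_one_sub_sub_le hx0 hx
  have hp0 : 0 ≤ √(1 - x) := Real.sqrt_nonneg _
  have hp1 : √(1 - x) ≤ 1 := Real.sqrt_le_one.2 (by linarith)
  have hd : |Real.exp (x * S / 2) - (1 + x * L / 2)| ≤ 2 * x ^ 2 := by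
    rw [abs_le]
    constructor <;> nlinarith
  have hxL : 0 ≤ x * L := mul_nonneg hx0 hL0
  have hxL' : x * L ≤ x := mul_le_of_le_one_right hx0 hL1
  calc |√(1 - x) * Real.exp (x * S / 2) - (1 - x / 2 + x * L / 2)|
      = |√(1 - x) * (Real.exp (x * S / 2) - (1 + x * L / 2))
          + (√(1 - x) - (1 - x / 2)) * (1 + x * L / 2) + -(x ^ 2 * L / 4)| := by
        congr 1
        ring
    _ ≤ 1 * (2 * x ^ 2) + x ^ 2 * (5 / 4) + x ^ 2 / 4 := by
        refine (abs_add_three _ _ _).trans ?_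
        rw [abs_mul, abs_mul, abs_neg, abs_of_nonneg hp0,
          abs_of_nonneg (by linarith : 0 ≤ 1 + x * L / 2),
          abs_of_nonneg (by positivity : 0 ≤ x ^ 2 * L / 4)]
        have : x ^ 2 * L ≤ x ^ 2 := mul_le_of_le_one_right (sq_nonneg x) hL1
        gcongr
        linarith
    _ ≤ 4 * x ^ 2 := by nlinarith [sq_nonneg x]

theorem abs_c_sub_le {k : ℕ} (hk : 2 ≤ k) :
    |c k - (√(k : ℝ) - t₂ / (2 * √(k : ℝ)))| ≤ 4 * (k : ℝ) ^ (-(3 / 2) : ℝ) := by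
  have hk' : (2 : ℝ) ≤ k := by exact_mod_cast hk
  have hk0 : (0 : ℝ) < k := by linarith
  have hs : 0 < √(k : ℝ) := Real.sqrt_pos.2 hk0
  have hss : √(k : ℝ) * √(k : ℝ) = k := Real.mul_self_sqrt hk0.le
  set x : ℝ := (k : ℝ)⁻¹ with hx
  have hx0 : 0 ≤ x := by positivity
  have hx1 : x ≤ 1 / 2 := by
    rw [hx, ← one_div]
    exact one_div_le_one_div_of_le two_pos hk'
  have hpi : Real.pi ^ 2 / 12 ≤ 1 := by nlinarith [Real.pi_pos, Real.pi_lt_d2]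
  have hS : |harmonicLogSum k - Real.pi ^ 2 / 12| ≤ 2 * x := by
    refine (abs_harmonicLogSum_sub_le hk).trans ?_
    rw [hx, ← div_eq_mul_inv, div_le_div_iff₀ (by linarith) hk0]
    linarith
  have key := abs_sqrt_mul_exp_sub_le hx0 hx1 (by positivity) hpi hS
  have hsqrt : √((k : ℝ) - 1) = √(k : ℝ) * √(1 - x) := by
    rw [← Real.sqrt_mul hk0.le, mul_sub, hx, mul_inv_cancel₀ hk0.ne', mul_one]
  have hpow : (k : ℝ) ^ (-(3 / 2) : ℝ) = √(k : ℝ) * x ^ 2 := by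
    rw [Real.sqrt_eq_rpow, hx, inv_pow, ← Real.rpow_natCast, ← Real.rpow_neg hk0.le,
      ← Real.rpow_add hk0]
    norm_num
  have hdiv : t₂ / (2 * √(k : ℝ)) = √(k : ℝ) * (x * t₂ / 2) := by
    rw [hx]
    field_simp
    rw [Real.sq_sqrt hk0.le]
  have hfac : c k - (√(k : ℝ) - t₂ / (2 * √(k : ℝ))) = √(k : ℝ) *
      (√(1 - x) * Real.exp (x * harmonicLogSum k / 2)
        - (1 - x / 2 + x * (Real.pi ^ 2 / 12) / 2)) := by
    rw [c_eq hk, hsqrt, hdiv, t₂,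
      show harmonicLogSum k / (2 * k) = x * harmonicLogSum k / 2 by rw [hx]; ring]
    ring
  rw [hfac, hpow, abs_mul, abs_of_pos hs]
  calc _ ≤ √(k : ℝ) * (4 * x ^ 2) := by gcongr
    _ = _ := by ring

theorem abs_t₂_sub_lt : |t₂ - 0.178| < 0.0005 := by
  have h1 := Real.pi_gt_d4
  have h2 := Real.pi_lt_d4
  rw [t₂, abs_lt]
  constructor <;> nlinarith

end RowSumDet

theorem mainTheorem1 :
    (∀ n k : ℕ, 1 ≤ k → k ≤ n → RowSumDet.M n k ≤ RowSumDet.c k ^ n) ∧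
    (fun k : ℕ => RowSumDet.c k - (√(k : ℝ) - RowSumDet.t₂ / (2 * √(k : ℝ))))
      =O[atTop] (fun k : ℕ => (k : ℝ) ^ (-(3 / 2) : ℝ)) ∧
    |RowSumDet.t₂ - 0.178| < 0.0005 := by
  refine ⟨fun n k hk hkn => RowSumDet.M_le_c_pow hk hkn, ?_, RowSumDet.abs_t₂_sub_lt⟩
  refine IsBigO.of_bound 4 ?_
  filter_upwards [eventually_ge_atTop 2] with k hk
  rw [Real.norm_eq_abs, Real.norm_of_nonneg (by positivity)]
  exact RowSumDet.abs_c_sub_le hk
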